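/- Theorem B. Let $p$ be a prime, let $G$ be a finite $p$-group, and let $\chi,\psi$ be irreducible complex characters of $G$. Write $\operatorname{Irr}(G)$ for the set of irreducible complex characters of $G$, $[\cdot,\cdot]$ for the usual inner product of complex class functions, and $\eta(\chi\psi)$ for the number of distinct irreducible constituents of the product character $\chi\psi$. Assume that $\eta(\chi\psi)<p$. Let $N$ be a normal subgroup of $G$ and let $\alpha,\gamma\in\operatorname{Irr}(N)$. If the induced character satisfies $\alpha^G=e\chi$ for some integer $e$, and $[\gamma,(\chi\psi)_N]\neq 0$, where $(\chi\psi)_N$ is the restriction of $\chi\psi$ to $N$, then $\gamma^G$ is a positive integer multiple of an irreducible character of $G$. In particular, if $|G:N|=p$, then $\gamma^G\in\operatorname{Irr}(G)$. -/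

import Mathlib

namespace CharacterTheory

/-- `Irr G`: the set of (complex-valued functions that are) characters of irreducible
finite-dimensional complex representations of `G`. -/
def Irr (G : Type*) [Group G] : Set (G → ℂ) :=
  {χ | ∃ (n : ℕ) (ρ : Representation ℂ G (Fin n → ℂ)), ρ.IsIrreducible ∧ ρ.character = χ}

/-- The usual inner product `[χ, θ] = |G|⁻¹ ∑ g, χ(g) * conj (θ(g))` of complex-valued functions
on a finite group. -/
noncomputable def charInner {G : Type*} [Group G] [Finite G] (χ θ : G → ℂ) : ℂ :=
  (Nat.card G : ℂ)⁻¹ * ∑ᶠ g : G, χ g * starRingEnd ℂ (θ g)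

/-- The set of irreducible constituents of `χ`. -/
def constituents {G : Type*} [Group G] [Finite G] (χ : G → ℂ) : Set (G → ℂ) :=
  {θ | θ ∈ Irr G ∧ charInner χ θ ≠ 0}

/-- `eta χ`: the number of distinct irreducible constituents of `χ`. -/
noncomputable def eta {G : Type*} [Group G] [Finite G] (χ : G → ℂ) : ℕ∞ :=
  (constituents χ).encard

/-- The restriction of `χ` to the subgroup `H`. -/
def restrict {G : Type*} [Group G] (H : Subgroup G) (χ : G → ℂ) : H → ℂ :=
  fun h => χ h

open Classical in
/-- The function induced from the subgroup `H`: `g ↦ |H|⁻¹ ∑ x, φ°(x g x⁻¹)`, where `φ°` is `φ`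
on `H` and `0` elsewhere. -/
noncomputable def induce {G : Type*} [Group G] [Finite G] (H : Subgroup G) (φ : H → ℂ) : G → ℂ :=
  fun g => (Nat.card H : ℂ)⁻¹ *
    ∑ᶠ x : G, if h : x * g * x⁻¹ ∈ H then φ ⟨x * g * x⁻¹, h⟩ else 0

end CharacterTheory

/-!
Write `φ^G` for `induce N φ` and `θ_N` for `restrict N θ`.

The theorem combines two facts. First, if `α^G = e χ`, then every irreducible constituent of `γ^G`
is a constituent of `χψ` (`constituents_induce_subset`): since `e χψ = (α ψ_N)^G`, Frobenius
reciprocity gives `e [χψ, θ] = [α ψ_N, θ_N]`. If this vanishes for some constituent `θ` of `γ^G`,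
then no conjugate of `γ` occurs in `α ψ_N`; equivalently `γ` does not occur in `α^x ψ_N` for any
conjugate `α^x`, and summing over `x` shows that it does not occur in `e (χψ)_N`. So `γ^G` has fewer
than `p` distinct irreducible constituents.

Second, in a `p`-group the number `r` of distinct irreducible constituents of `γ^G` is `1` or at
least `p` (`induce_eq_smul_of_encard_constituents_lt`). The multiplicity `m_θ = [γ, θ_N]` divides
`θ(1)`, because by Clifford's theorem all constituents of `θ_N` are conjugates of `γ` with this same
multiplicity (`multiplicity_dvd_degree`). Degrees divide the group order (`finrank_dvd_card`), so
`m_θ` is a power of `p`. The sum of the `m_θ ^ 2` is `[γ^G, γ^G]`, the index of `N` in the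
stabiliser of `γ` (`exists_charInner_induce_self`), which is again a power of `p`. Reducing modulo
`p - 1` gives `r ≡ 1`. When `r = 1`, the square of the only multiplicity divides `|G : N|`, so the
multiplicity is `1` if `|G : N| = p`.

The character theory this rests on is completeness of the irreducible characters among class
functions, obtained from Schur's lemma and the vanishing of the Jacobson radical of `ℂ[G]`
(`eq_zero_of_forall_charInner_eq_zero`), and the integrality of `|G| / χ(1)`.
-/

namespace CharacterTheory

open scoped MonoidAlgebra ComplexOrder
open Module Representation

/-! ### Traces of matrix representations -/

section Matrices

/-- The averaged form `∑ r(x)ᴴ r(x)` is positive definite and invariant, so `r(g)ᴴ` is conjugate to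
`r(g⁻¹)`. -/
theorem star_trace_map_eq_trace_map_inv {G n : Type*} [Group G] [Finite G] [Fintype n]
    [DecidableEq n] (r : G →* Matrix n n ℂ) (g : G) :
    star (r g).trace = (r g⁻¹).trace := by
  classical
  have := Fintype.ofFinite G
  set P : Matrix n n ℂ := ∑ x, (r x).conjTranspose * r x with hP
  have hpos : P.PosDef := by
    have h1 : P = (r 1).conjTranspose * r 1 +
        ∑ x ∈ Finset.univ.erase 1, (r x).conjTranspose * r x :=
      (Finset.add_sum_erase _ _ (Finset.mem_univ 1)).symm
    rw [h1]
    refine Matrix.PosDef.add_posSemidef (by simpa using Matrix.PosDef.one) ?_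
    exact Matrix.posSemidef_sum _ fun x _ => Matrix.posSemidef_conjTranspose_mul_self _
  have hinv : (r g).conjTranspose * P * r g = P := by
    rw [hP, Finset.mul_sum, Finset.sum_mul]
    refine Fintype.sum_equiv (Equiv.mulRight g) _ _ fun x => ?_
    simp [Matrix.conjTranspose_mul, mul_assoc]
  have hu : IsUnit P.det := (Matrix.isUnit_iff_isUnit_det _).mp hpos.isUnit
  have h2 : (r g).conjTranspose = P * r g⁻¹ * P⁻¹ := by
    have h3 : r g * r g⁻¹ = 1 := by rw [← map_mul]; simp
    calc (r g).conjTranspose = (r g).conjTranspose * P * (r g * r g⁻¹) * P⁻¹ := by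
          rw [h3, mul_one, mul_assoc, Matrix.mul_nonsing_inv _ hu, mul_one]
      _ = ((r g).conjTranspose * P * r g) * r g⁻¹ * P⁻¹ := by simp only [mul_assoc]
      _ = _ := by rw [hinv]
  rw [← Matrix.trace_conjTranspose, h2, Matrix.trace_mul_cycle,
    Matrix.nonsing_inv_mul _ hu, one_mul]

end Matrices

/-! ### Characters and irreducibility -/

section Characters

variable {G : Type*} [Group G]

theorem star_character [Finite G] {V : Type*} [AddCommGroup V] [Module ℂ V]
    [FiniteDimensional ℂ V] (ρ : Representation ℂ G V) (g : G) :
    starRingEnd ℂ (ρ.character g) = ρ.character g⁻¹ := by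
  classical
  let b := finBasis ℂ V
  let r : G →* Matrix _ _ ℂ := ((LinearMap.toMatrixAlgEquiv b).toMulEquiv.toMonoidHom).comp ρ
  have h : ∀ x, ρ.character x = (r x).trace := fun x => by
    simp only [character, LinearMap.trace_eq_matrix_trace ℂ b]; rfl
  rw [h, h]
  exact star_trace_map_eq_trace_map_inv r g

/-- A function on `G` is a character if it is afforded by a finite-dimensional complex
representation; the representation space is normalised to `Fin n → ℂ`, as in `Irr`. -/
def IsCharacter (χ : G → ℂ) : Prop :=
  ∃ (n : ℕ) (ρ : Representation ℂ G (Fin n → ℂ)), ρ.character = χ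

theorem Irr.isCharacter {χ : G → ℂ} (h : χ ∈ Irr G) : IsCharacter χ :=
  let ⟨n, ρ, _, h⟩ := h; ⟨n, ρ, h⟩

/-- Irreducibility phrased with invariant subspaces. -/
theorem isIrreducible_iff_forall_invariant {V : Type*} [AddCommGroup V] [Module ℂ V]
    (ρ : Representation ℂ G V) :
    ρ.IsIrreducible ↔ Nontrivial V ∧
      ∀ W : Submodule ℂ V, (∀ g, W ≤ W.comap (ρ g)) → W = ⊥ ∨ W = ⊤ := by
  have hinj : Function.Injective (Subrepresentation.toSubmodule (ρ := ρ)) :=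
    Subrepresentation.toSubmodule_injective
  have hbot : (⊥ : Subrepresentation ρ).toSubmodule = ⊥ := rfl
  have htop : (⊤ : Subrepresentation ρ).toSubmodule = ⊤ := rfl
  constructor
  · intro h
    refine ⟨?_, fun W hW => ?_⟩
    · by_contra hV
      rw [not_nontrivial_iff_subsingleton] at hV
      exact bot_ne_top (α := Subrepresentation ρ) (hinj (Subsingleton.elim _ _))
    · rcases eq_bot_or_eq_top (⟨W, fun g => hW g⟩ : Subrepresentation ρ) with h | h
      · left; rw [← hbot, ← h]
      · right; rw [← htop, ← h]
  · rintro ⟨h1, h2⟩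
    have : Nontrivial (Subrepresentation ρ) := ⟨⊥, ⊤, fun h => by
      have := congrArg Subrepresentation.toSubmodule h
      rw [hbot, htop] at this
      exact bot_ne_top this⟩
    exact ⟨fun W => (h2 W.toSubmodule fun g => W.apply_mem_toSubmodule g).imp
      (fun h => hinj h) (fun h => hinj h)⟩

/-- The representation on `Fin n → ℂ` obtained from `ρ` by choosing a basis. -/
noncomputable def coordRep {V : Type*} [AddCommGroup V] [Module ℂ V] [FiniteDimensional ℂ V]
    (ρ : Representation ℂ G V) : Representation ℂ G (Fin (finrank ℂ V) → ℂ) :=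
  ((finBasis ℂ V).equivFun.conjAlgEquiv ℂ : _ →* _).comp ρ

theorem coordRep_apply {V : Type*} [AddCommGroup V] [Module ℂ V] [FiniteDimensional ℂ V]
    (ρ : Representation ℂ G V) (g : G) :
    coordRep ρ g = (finBasis ℂ V).equivFun.conj (ρ g) := rfl

theorem character_coordRep {V : Type*} [AddCommGroup V] [Module ℂ V] [FiniteDimensional ℂ V]
    (ρ : Representation ℂ G V) : (coordRep ρ).character = ρ.character := by
  funext g
  simp only [character, coordRep_apply, LinearMap.trace_conj']

theorem isCharacter_character {V : Type*} [AddCommGroup V] [Module ℂ V] [FiniteDimensional ℂ V]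
    (ρ : Representation ℂ G V) : IsCharacter ρ.character :=
  ⟨_, coordRep ρ, character_coordRep ρ⟩

theorem character_mem_irr {V : Type*} [AddCommGroup V] [Module ℂ V] [FiniteDimensional ℂ V]
    (ρ : Representation ℂ G V) (h : ρ.IsIrreducible) : ρ.character ∈ Irr G := by
  refine ⟨_, coordRep ρ, ?_, character_coordRep ρ⟩
  rw [isIrreducible_iff_forall_invariant] at h ⊢
  obtain ⟨h1, h2⟩ := h
  set E := (finBasis ℂ V).equivFun with hE
  refine ⟨E.symm.nontrivial, fun W hW => ?_⟩
  have key := h2 (W.comap (E : V →ₗ[ℂ] _)) fun g v hv => by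
    have := hW g hv
    simpa [coordRep_apply, ← hE, LinearEquiv.conj_apply] using this
  refine key.imp (fun h => ?_) (fun h => ?_)
  · rw [eq_bot_iff]
    intro w hw
    have : E.symm w ∈ W.comap (E : V →ₗ[ℂ] _) := by simpa using hw
    rw [h] at this
    simpa using this
  · rw [eq_top_iff]
    intro w _
    have : E.symm w ∈ W.comap (E : V →ₗ[ℂ] _) := by rw [h]; trivial
    simpa using this

theorem IsCharacter.mul {χ ψ : G → ℂ} (hχ : IsCharacter χ) (hψ : IsCharacter ψ) :
    IsCharacter (χ * ψ) := by
  obtain ⟨n, ρ, rfl⟩ := hχ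
  obtain ⟨m, σ, rfl⟩ := hψ
  rw [← char_tensor]
  exact isCharacter_character _

/-- Pulling a character back along a homomorphism gives a character. -/
theorem IsCharacter.comp {H : Type*} [Group H] {χ : G → ℂ} (hχ : IsCharacter χ) (f : H →* G) :
    IsCharacter (χ ∘ f) := by
  obtain ⟨n, ρ, rfl⟩ := hχ
  exact ⟨n, ρ.comp f, rfl⟩

theorem IsCharacter.restrict {χ : G → ℂ} (hχ : IsCharacter χ) (H : Subgroup G) :
    IsCharacter (restrict H χ) :=
  hχ.comp H.subtype

theorem Irr.comp_mulEquiv {H : Type*} [Group H] {χ : G → ℂ} (hχ : χ ∈ Irr G) (f : H ≃* G) :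
    χ ∘ f ∈ Irr H := by
  obtain ⟨n, ρ, h, rfl⟩ := hχ
  refine ⟨n, ρ.comp f.toMonoidHom, ?_, rfl⟩
  rw [isIrreducible_iff_forall_invariant] at h ⊢
  refine ⟨h.1, fun W hW => h.2 W fun g => ?_⟩
  simpa using hW (f.symm g)

theorem IsCharacter.conj_apply {χ : G → ℂ} (hχ : IsCharacter χ) (x g : G) :
    χ (x * g * x⁻¹) = χ g := by
  obtain ⟨n, ρ, rfl⟩ := hχ
  simp

end Characters

/-! ### Orthonormality of the irreducible characters -/

section InnerProduct

variable {G : Type*} [Group G] [Finite G]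

theorem charInner_eq_sum [Fintype G] (χ θ : G → ℂ) :
    charInner χ θ = (Nat.card G : ℂ)⁻¹ * ∑ g : G, χ g * starRingEnd ℂ (θ g) := by
  rw [charInner, finsum_eq_sum_of_fintype]

theorem charInner_sum_left {ι : Type*} (s : Finset ι) (f : ι → G → ℂ) (θ : G → ℂ) :
    charInner (∑ i ∈ s, f i) θ = ∑ i ∈ s, charInner (f i) θ := by
  have := Fintype.ofFinite G
  simp only [charInner_eq_sum, Finset.sum_apply, Finset.sum_mul]
  rw [Finset.sum_comm, Finset.mul_sum]

theorem charInner_smul_left (c : ℂ) (χ θ : G → ℂ) :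
    charInner (c • χ) θ = c * charInner χ θ := by
  have := Fintype.ofFinite G
  simp only [charInner_eq_sum, Pi.smul_apply, smul_eq_mul, mul_assoc, ← Finset.mul_sum]
  ring

theorem charInner_sub_left (χ ψ θ : G → ℂ) :
    charInner (χ - ψ) θ = charInner χ θ - charInner ψ θ := by
  have := Fintype.ofFinite G
  simp only [charInner_eq_sum, Pi.sub_apply, sub_mul, Finset.sum_sub_distrib, mul_sub]

theorem star_charInner (χ θ : G → ℂ) : starRingEnd ℂ (charInner χ θ) = charInner θ χ := by
  have := Fintype.ofFinite G
  simp [charInner_eq_sum, mul_comm]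

/-- Inner products of characters are dimensions of spaces of intertwining maps. -/
theorem IsCharacter.exists_charInner_eq_natCast {χ θ : G → ℂ} (hχ : IsCharacter χ)
    (hθ : IsCharacter θ) : ∃ m : ℕ, charInner χ θ = m := by
  have := Fintype.ofFinite G
  have := invertibleOfNonzero (NeZero.ne (Nat.card G : ℂ))
  obtain ⟨n, ρ, rfl⟩ := hχ
  obtain ⟨m, σ, rfl⟩ := hθ
  refine ⟨finrank ℂ (IntertwiningMap σ ρ), ?_⟩
  rw [charInner_eq_sum, ← card_inv_mul_sum_char_mul_char_eq_finrank]
  simp_rw [star_character]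

theorem IsCharacter.charInner_comm {χ θ : G → ℂ} (hχ : IsCharacter χ)
    (hθ : IsCharacter θ) : charInner χ θ = charInner θ χ := by
  obtain ⟨m, h⟩ := hχ.exists_charInner_eq_natCast hθ
  rw [← star_charInner χ θ, h, map_natCast]

theorem charInner_self_of_mem_irr {χ : G → ℂ} (hχ : χ ∈ Irr G) : charInner χ χ = 1 := by
  have := Fintype.ofFinite G
  have := invertibleOfNonzero (NeZero.ne (Nat.card G : ℂ))
  obtain ⟨n, ρ, h, rfl⟩ := hχ
  have := char_orthonormal ρ ρ
  rw [if_pos ⟨Representation.Equiv.refl ρ⟩] at this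
  rw [charInner_eq_sum, ← this]
  simp_rw [star_character]

theorem charInner_eq_zero_of_mem_irr {χ θ : G → ℂ} (hχ : χ ∈ Irr G) (hθ : θ ∈ Irr G)
    (hne : χ ≠ θ) : charInner χ θ = 0 := by
  have := Fintype.ofFinite G
  have := invertibleOfNonzero (NeZero.ne (Nat.card G : ℂ))
  obtain ⟨n, ρ, h, rfl⟩ := hχ
  obtain ⟨m, σ, h', rfl⟩ := hθ
  have := char_orthonormal ρ σ
  rw [if_neg fun ⟨e⟩ => hne (char_iso e).symm] at this
  rw [charInner_eq_sum, ← this]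
  simp_rw [star_character]

theorem irr_linearIndepOn : LinearIndepOn ℂ id (Irr G) := by
  rw [linearIndepOn_iff']
  intro s c hs h0 θ hθ
  have h1 : charInner (∑ i ∈ s, c i • id i) θ = 0 := by
    rw [h0]; simpa using charInner_smul_left 0 (0 : G → ℂ) θ
  rw [charInner_sum_left, Finset.sum_eq_single θ] at h1
  · simpa [charInner_smul_left, charInner_self_of_mem_irr (hs hθ)] using h1
  · intro β hβ hne
    simp [charInner_smul_left, charInner_eq_zero_of_mem_irr (hs hβ) (hs hθ) hne]
  · exact fun h => absurd hθ h

variable (G) in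
theorem irr_finite : (Irr G).Finite :=
  (irr_linearIndepOn (G := G)).linearIndependent.setFinite

end InnerProduct

/-! ### Completeness of the irreducible characters -/

section Completeness

variable {G : Type*} [Group G]

/-- For a class function `f`, the operator `∑ f(g) ρ(g)` is intertwining, hence a scalar by Schur's
lemma; its trace determines the scalar. -/
theorem sum_smul_apply_eq_smul_one [Fintype G] {V : Type*} [AddCommGroup V] [Module ℂ V]
    [FiniteDimensional ℂ V] (ρ : Representation ℂ G V) (hρ : ρ.IsIrreducible) (f : G → ℂ)
    (hf : ∀ x g, f (x * g * x⁻¹) = f g) :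
    ∑ g, f g • ρ g = ((∑ g, f g * ρ.character g) / finrank ℂ V) • (1 : End ℂ V) := by
  let a : IntertwiningMap ρ ρ := ⟨∑ g, f g • ρ g, fun x => by
    ext v
    simp only [LinearMap.comp_apply, LinearMap.sum_apply, LinearMap.smul_apply, map_sum, map_smul]
    refine Fintype.sum_equiv (MulAut.conj x⁻¹).toEquiv _ _ fun g => ?_
    simp only [MulEquiv.toEquiv_eq_coe, EquivLike.coe_coe, MulAut.conj_apply, hf]
    congr 1
    simp only [← Module.End.mul_apply, ← map_mul]
    congr 2
    group⟩
  obtain ⟨c, hc⟩ := (IsIrreducible.algebraMap_intertwiningMap_bijective_of_isAlgClosed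
    (ρ := ρ)).2 a
  have h1 : ∑ g, f g • ρ g = c • (1 : End ℂ V) := by
    have h2 : a.toLinearMap = c • (1 : End ℂ V) := by
      rw [← hc, Algebra.algebraMap_eq_smul_one]; rfl
    exact h2
  have hV : Nontrivial V := ((isIrreducible_iff_forall_invariant ρ).1 hρ).1
  have hn : (finrank ℂ V : ℂ) ≠ 0 := by exact_mod_cast finrank_pos.ne'
  have h3 := congrArg (LinearMap.trace ℂ V) h1
  rw [map_sum, map_smul, LinearMap.trace_one] at h3
  simp only [map_smul, smul_eq_mul] at h3
  rw [h1]
  congr 1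
  rw [eq_div_iff hn, ← h3]
  rfl

/-- A class function orthogonal to all irreducible characters vanishes: the corresponding central
element of `ℂ[G]` kills every simple module, so it lies in the Jacobson radical, which is zero by
Maschke's theorem. -/
theorem eq_zero_of_forall_charInner_eq_zero [Finite G] (f : G → ℂ)
    (hf : ∀ x g, f (x * g * x⁻¹) = f g) (h : ∀ θ ∈ Irr G, charInner f θ = 0) : f = 0 := by
  have := Fintype.ofFinite G
  set z : ℂ[G] := ∑ g, MonoidAlgebra.single g (f g⁻¹) with hz
  have hjac : z ∈ Ring.jacobson ℂ[G] := by
    rw [Ring.jacobson, Module.jacobson, Submodule.mem_sInf]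
    intro I hI
    have hsimple : IsSimpleModule ℂ[G] (ℂ[G] ⧸ I) := isSimpleModule_iff_isCoatom.2 hI
    let ρ : Representation ℂ G (ℂ[G] ⧸ I) := Representation.ofModule' (ℂ[G] ⧸ I)
    have hρ : ∀ g v, ρ g v = MonoidAlgebra.single g (1 : ℂ) • v := fun g v => rfl
    have hsm : ∀ (c : ℂ) g (v : ℂ[G] ⧸ I), MonoidAlgebra.single g c • v = c • ρ g v := by
      intro c g v
      rw [hρ, ← smul_assoc, MonoidAlgebra.smul_single, smul_eq_mul, mul_one]
    have hirr : ρ.IsIrreducible := by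
      rw [isIrreducible_iff_forall_invariant]
      refine ⟨IsSimpleModule.nontrivial ℂ[G] _, fun W hW => ?_⟩
      -- A `G`-invariant subspace of `ℂ[G] ⧸ I` is a `ℂ[G]`-submodule.
      let W' : Submodule ℂ[G] (ℂ[G] ⧸ I) :=
        { W with
          smul_mem' := fun a v hv => by
            induction a using MonoidAlgebra.induction_linear with
            | zero => simp
            | add a b ha hb => rw [add_smul]; exact W.add_mem ha hb
            | single g c => rw [hsm]; exact W.smul_mem _ (hW g hv) }
      refine (eq_bot_or_eq_top W').imp (fun h => ?_) (fun h => ?_)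
      · ext v; exact (SetLike.ext_iff.1 h v)
      · ext v; exact (SetLike.ext_iff.1 h v)
    have hfin : FiniteDimensional ℂ (ℂ[G] ⧸ I) :=
      Module.Finite.trans ℂ[G] (ℂ[G] ⧸ I)
    have hθ := h _ (character_mem_irr ρ hirr)
    have hsum : ∑ g, f g⁻¹ * ρ.character g = 0 := by
      rw [charInner_eq_sum, mul_eq_zero] at hθ
      replace hθ := hθ.resolve_left (inv_ne_zero (NeZero.ne _))
      rw [← hθ]
      refine Fintype.sum_equiv (Equiv.inv G) _ _ fun g => ?_
      rw [star_character]; simp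
    have hop := sum_smul_apply_eq_smul_one ρ hirr (fun g => f g⁻¹) fun x g => by
      rw [← hf x g⁻¹]; congr 1; group
    rw [hsum, zero_div, zero_smul] at hop
    have h1 : z • (Submodule.Quotient.mk 1 : ℂ[G] ⧸ I) = 0 := by
      rw [hz, Finset.sum_smul]
      simp only [hsm]
      simpa using congrArg (fun a : End ℂ (ℂ[G] ⧸ I) => a (Submodule.Quotient.mk 1)) hop
    rw [← Submodule.Quotient.mk_smul, Submodule.Quotient.mk_eq_zero] at h1
    simpa using h1
  have hart : IsArtinianRing ℂ[G] := IsArtinianRing.of_finite ℂ _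
  rw [IsArtinianRing.isSemisimpleRing_iff_jacobson.1 inferInstance, Submodule.mem_bot] at hjac
  funext g
  have h2 := congrArg (fun a : ℂ[G] => a.coeff g⁻¹) hjac
  classical
  simpa [hz, Finsupp.single_apply] using h2

variable (G) in
/-- The irreducible characters of a finite group, as a finite set. -/
noncomputable def irrFinset [Finite G] : Finset (G → ℂ) := (irr_finite G).toFinset

@[simp]
theorem mem_irrFinset [Finite G] {χ : G → ℂ} : χ ∈ irrFinset G ↔ χ ∈ Irr G :=
  (irr_finite G).mem_toFinset

theorem sum_charInner_smul_eq [Finite G] (f : G → ℂ) (hf : ∀ x g, f (x * g * x⁻¹) = f g) :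
    ∑ θ ∈ irrFinset G, charInner f θ • θ = f := by
  symm
  rw [← sub_eq_zero]
  refine eq_zero_of_forall_charInner_eq_zero _ (fun x g => ?_) fun β hβ => ?_
  · simp only [Pi.sub_apply, Finset.sum_apply, Pi.smul_apply, hf]
    congr 1
    exact Finset.sum_congr rfl fun θ hθ => by
      rw [(Irr.isCharacter (mem_irrFinset.1 hθ)).conj_apply]
  · rw [charInner_sub_left, charInner_sum_left, Finset.sum_eq_single_of_mem β (by simpa)]
    · rw [charInner_smul_left, charInner_self_of_mem_irr hβ, mul_one, sub_self]
    · intro θ hθ hne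
      rw [charInner_smul_left, charInner_eq_zero_of_mem_irr (mem_irrFinset.1 hθ) hβ hne, mul_zero]

/-- Parseval's identity; only one of the two functions needs to be a class function. -/
theorem charInner_eq_sum_irr [Finite G] (f h : G → ℂ) (hf : ∀ x g, f (x * g * x⁻¹) = f g) :
    charInner f h = ∑ θ ∈ irrFinset G, charInner f θ * charInner θ h := by
  conv_lhs => rw [← sum_charInner_smul_eq f hf]
  rw [charInner_sum_left]
  exact Finset.sum_congr rfl fun θ _ => charInner_smul_left _ _ _

end Completeness

/-! ### Degrees divide the group order -/

section Degree

variable {G : Type*} [Group G] [Finite G]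

/-- The trace is the sum of the eigenvalues, which are roots of unity. -/
theorem isIntegral_character {V : Type*} [AddCommGroup V] [Module ℂ V] [FiniteDimensional ℂ V]
    (ρ : Representation ℂ G V) (g : G) : IsIntegral ℤ (ρ.character g) := by
  classical
  let b := finBasis ℂ V
  rw [character, LinearMap.trace_eq_matrix_trace ℂ b, Matrix.trace_eq_sum_roots_charpoly]
  refine IsIntegral.multiset_sum fun μ hμ => ?_
  have hroot : (LinearMap.charpoly (ρ g)).IsRoot μ := by
    rw [← LinearMap.charpoly_toMatrix (ρ g) b]
    exact Polynomial.isRoot_of_mem_roots hμ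
  rw [← Module.End.hasEigenvalue_iff_isRoot_charpoly] at hroot
  obtain ⟨v, hv⟩ := hroot.exists_hasEigenvector
  have h1 := hv.pow_apply (Nat.card G)
  rw [← map_pow ρ, pow_card_eq_one' (G := G), map_one, Module.End.one_apply] at h1
  have h2 : μ ^ Nat.card G = 1 := by
    have h3 : (μ ^ Nat.card G - 1) • v = 0 := by rw [sub_smul, ← h1, one_smul, sub_self]
    exact sub_eq_zero.1 ((smul_eq_zero.1 h3).resolve_right hv.2)
  refine IsIntegral.of_pow (Nat.card_pos (α := G)) ?_
  rw [h2]
  exact isIntegral_one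

/-- The degree of an irreducible character divides the group order: the central element
`∑ χ(g⁻¹) g` of the group ring over the algebraic integers is integral and acts as the scalar
`|G| / χ(1)`. -/
theorem finrank_dvd_card {V : Type*} [AddCommGroup V] [Module ℂ V] [FiniteDimensional ℂ V]
    (ρ : Representation ℂ G V) (hρ : ρ.IsIrreducible) : finrank ℂ V ∣ Nat.card G := by
  have := Fintype.ofFinite G
  have hV : Nontrivial V := ((isIrreducible_iff_forall_invariant ρ).1 hρ).1
  have hn : (finrank ℂ V : ℂ) ≠ 0 := by exact_mod_cast finrank_pos.ne'
  let O := integralClosure ℤ ℂ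
  have hop := sum_smul_apply_eq_smul_one ρ hρ (fun g => ρ.character g⁻¹) fun x g => by
    rw [← char_conj ρ g⁻¹ x]; congr 1; group
  have hsum : ∑ g, ρ.character g⁻¹ * ρ.character g = Nat.card G := by
    have h1 := charInner_self_of_mem_irr (character_mem_irr ρ hρ)
    rw [charInner_eq_sum, inv_mul_eq_one₀ (NeZero.ne _)] at h1
    rw [h1]
    exact Finset.sum_congr rfl fun g _ => by rw [star_character, mul_comm]
  rw [hsum] at hop
  let F : O[G] →ₐ[O] End ℂ V := MonoidAlgebra.lift O (End ℂ V) G ρ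
  have hint : IsIntegral O ((Nat.card G / finrank ℂ V : ℂ) • (1 : End ℂ V)) := by
    -- `O[G]` is a finite `O`-module, so all of its elements are integral over `O`.
    let z : O[G] := ∑ g, MonoidAlgebra.single g ⟨ρ.character g⁻¹, isIntegral_character ρ g⁻¹⟩
    have hz : F z = (Nat.card G / finrank ℂ V : ℂ) • (1 : End ℂ V) := by
      rw [← hop, map_sum]
      refine Finset.sum_congr rfl fun g _ => ?_
      rw [MonoidAlgebra.lift_single]
      rfl
    rw [← hz]
    exact (IsIntegral.of_finite O z).map F
  rw [← Algebra.algebraMap_eq_smul_one, isIntegral_algebraMap_iff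
    (FaithfulSMul.algebraMap_injective ℂ (End ℂ V))] at hint
  have hintZ : IsIntegral ℤ (Nat.card G / finrank ℂ V : ℂ) := isIntegral_trans (A := O) _ hint
  have hq : IsIntegral ℤ (Nat.card G / finrank ℂ V : ℚ) := by
    rw [← isIntegral_algebraMap_iff (FaithfulSMul.algebraMap_injective ℚ ℂ)]
    simpa using hintZ
  obtain ⟨k, hk⟩ := IsIntegrallyClosed.isIntegral_iff.1 hq
  have hnq : (finrank ℂ V : ℚ) ≠ 0 := by exact_mod_cast finrank_pos.ne'
  rw [eq_div_iff hnq] at hk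
  have hk' : k * (finrank ℂ V : ℤ) = Nat.card G := by
    rw [eq_intCast] at hk
    exact_mod_cast hk
  exact Int.natCast_dvd_natCast.1 ⟨k, by rw [← hk', mul_comm]⟩

theorem exists_degree_of_mem_irr {χ : G → ℂ} (hχ : χ ∈ Irr G) :
    ∃ d : ℕ, 0 < d ∧ d ∣ Nat.card G ∧ χ 1 = d := by
  obtain ⟨n, ρ, h, rfl⟩ := hχ
  have hV := ((isIrreducible_iff_forall_invariant ρ).1 h).1
  exact ⟨_, finrank_pos, finrank_dvd_card ρ h, char_one ρ⟩

end Degree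

/-! ### Induction and Frobenius reciprocity -/

section Induction

variable {G : Type*} [Group G]

open Classical in
/-- The extension by zero of a function on a subgroup. -/
noncomputable def extendZero (H : Subgroup G) (φ : H → ℂ) (g : G) : ℂ :=
  if h : g ∈ H then φ ⟨g, h⟩ else 0

theorem extendZero_coe (H : Subgroup G) (φ : H → ℂ) (h : H) : extendZero H φ h = φ h :=
  dif_pos h.2

theorem extendZero_of_notMem (H : Subgroup G) (φ : H → ℂ) {g : G} (hg : g ∉ H) :
    extendZero H φ g = 0 :=
  dif_neg hg

variable [Finite G]

theorem induce_apply [Fintype G] (H : Subgroup G) (φ : H → ℂ) (g : G) :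
    induce H φ g = (Nat.card H : ℂ)⁻¹ * ∑ x : G, extendZero H φ (x * g * x⁻¹) := by
  simp only [induce, finsum_eq_sum_of_fintype, extendZero]

theorem induce_conj_apply (H : Subgroup G) (φ : H → ℂ) (y g : G) :
    induce H φ (y * g * y⁻¹) = induce H φ g := by
  have := Fintype.ofFinite G
  rw [induce_apply, induce_apply]
  congr 1
  refine Fintype.sum_equiv (Equiv.mulRight y) _ _ fun x => congrArg _ ?_
  simp [mul_assoc]

/-- Frobenius reciprocity. -/
theorem charInner_induce (H : Subgroup G) (φ : H → ℂ) (χ : G → ℂ)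
    (hχ : ∀ x g, χ (x * g * x⁻¹) = χ g) :
    charInner (induce H φ) χ = charInner φ (restrict H χ) := by
  have := Fintype.ofFinite G
  have := Fintype.ofFinite H
  have hconj : ∀ x : G, ∑ g, extendZero H φ (x * g * x⁻¹) * starRingEnd ℂ (χ g) =
      ∑ g, extendZero H φ g * starRingEnd ℂ (χ g) := fun x =>
    Fintype.sum_equiv (MulAut.conj x).toEquiv _ _ fun g => by simp [hχ]
  have hsub : ∑ h : H, φ h * starRingEnd ℂ (restrict H χ h) =
      ∑ g, extendZero H φ g * starRingEnd ℂ (χ g) := by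
    refine Finset.sum_of_injOn (fun h : H => (h : G)) Subtype.val_injective.injOn
      (fun _ _ => Finset.mem_coe.2 (Finset.mem_univ _)) (fun g _ hg => ?_) fun h _ => ?_
    · rw [extendZero_of_notMem H φ fun h => hg ⟨⟨g, h⟩, by simp, rfl⟩, zero_mul]
    · rw [extendZero_coe]; rfl
  have hswap : ∑ g, induce H φ g * starRingEnd ℂ (χ g) =
      (Nat.card H : ℂ)⁻¹ * (Nat.card G * ∑ g, extendZero H φ g * starRingEnd ℂ (χ g)) := by
    simp only [induce_apply, mul_assoc (Nat.card H : ℂ)⁻¹, ← Finset.mul_sum]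
    simp only [Finset.sum_mul]
    rw [Finset.sum_comm]
    simp only [hconj, Finset.sum_const, Finset.card_univ, nsmul_eq_mul, Fintype.card_eq_nat_card]
  rw [charInner_eq_sum, charInner_eq_sum, hsub, hswap]
  have h0 : (Nat.card G : ℂ) ≠ 0 := NeZero.ne _
  field_simp

theorem induce_mul_restrict (H : Subgroup G) (φ : H → ℂ) (ψ : G → ℂ)
    (hψ : ∀ x g, ψ (x * g * x⁻¹) = ψ g) :
    induce H (φ * restrict H ψ) = induce H φ * ψ := by
  have := Fintype.ofFinite G
  funext g
  rw [Pi.mul_apply, induce_apply, induce_apply, mul_assoc, Finset.sum_mul]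
  congr 1
  refine Finset.sum_congr rfl fun x _ => ?_
  rw [← hψ x g]
  by_cases h : x * g * x⁻¹ ∈ H
  · exact (extendZero_coe H _ ⟨_, h⟩).trans
      (congrArg (· * ψ (x * g * x⁻¹)) (extendZero_coe H φ ⟨_, h⟩).symm)
  · rw [extendZero_of_notMem H _ h, extendZero_of_notMem H _ h, zero_mul]

theorem induce_apply_one (H : Subgroup G) (φ : H → ℂ) :
    induce H φ 1 = H.index * φ 1 := by
  have := Fintype.ofFinite G
  have h1 : ∀ x : G, extendZero H φ (x * 1 * x⁻¹) = φ 1 := fun x => by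
    rw [mul_one, mul_inv_cancel]; exact extendZero_coe H φ 1
  rw [induce_apply, Finset.sum_congr rfl fun x _ => h1 x, Finset.sum_const, Finset.card_univ,
    nsmul_eq_mul, Fintype.card_eq_nat_card, ← H.card_mul_index, Nat.cast_mul, mul_assoc,
    inv_mul_cancel_left₀ (NeZero.ne _)]

end Induction

/-! ### Conjugate characters and Clifford theory -/

section Clifford

variable {G : Type*} [Group G] (N : Subgroup G) [N.Normal]

/-- The conjugate `n ↦ γ (x n x⁻¹)` of a function on a normal subgroup. This is a right action of
`G`, see `conjFun_mul`. -/
def conjFun (x : G) (γ : N → ℂ) : N → ℂ := γ ∘ MulAut.conjNormal x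

variable {N}

theorem conjFun_apply (x : G) (γ : N → ℂ) (n : N) :
    conjFun N x γ n = γ (MulAut.conjNormal x n) := rfl

theorem conjFun_one (γ : N → ℂ) : conjFun N 1 γ = γ := by
  funext n; simp [conjFun_apply]

theorem conjFun_mul (x y : G) (γ : N → ℂ) :
    conjFun N (x * y) γ = conjFun N y (conjFun N x γ) := by
  funext n; simp [conjFun_apply]

theorem conjFun_mem_irr (x : G) {γ : N → ℂ} (hγ : γ ∈ Irr N) : conjFun N x γ ∈ Irr N :=
  Irr.comp_mulEquiv hγ _

theorem conjFun_restrict (x : G) (χ : G → ℂ) (hχ : ∀ x g, χ (x * g * x⁻¹) = χ g) :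
    conjFun N x (restrict N χ) = restrict N χ := by
  funext n; simp [conjFun_apply, restrict, hχ]

variable [Finite G]

theorem charInner_conjFun (x : G) (f h : N → ℂ) :
    charInner (conjFun N x f) (conjFun N x h) = charInner f h := by
  have := Fintype.ofFinite N
  simp only [charInner_eq_sum]
  congr 1
  exact Fintype.sum_equiv (MulAut.conjNormal x).toEquiv _ _ fun n => rfl

theorem charInner_conjFun_restrict (x : G) (γ : N → ℂ) (χ : G → ℂ)
    (hχ : ∀ x g, χ (x * g * x⁻¹) = χ g) :
    charInner (conjFun N x γ) (restrict N χ) = charInner γ (restrict N χ) := by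
  rw [← charInner_conjFun x γ, conjFun_restrict x χ hχ]

theorem restrict_induce [Fintype G] (γ : N → ℂ) :
    restrict N (induce N γ) = (Nat.card N : ℂ)⁻¹ • ∑ x : G, conjFun N x γ := by
  funext n
  rw [restrict, induce_apply, Pi.smul_apply, Finset.sum_apply, smul_eq_mul]
  congr 1
  exact Finset.sum_congr rfl fun x _ => extendZero_coe N γ (MulAut.conjNormal x n)

theorem eq_zero_of_sum_natCast_eq_zero {ι : Type*} {s : Finset ι} {a : ι → ℂ}
    (ha : ∀ i ∈ s, ∃ m : ℕ, a i = m) (h : ∑ i ∈ s, a i = 0) : ∀ i ∈ s, a i = 0 := by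
  choose! m hm using ha
  rw [Finset.sum_congr rfl hm] at h
  have h' : ∑ i ∈ s, m i = 0 := by exact_mod_cast h
  intro i hi
  rw [hm i hi, Finset.sum_eq_zero_iff.1 h' i hi, Nat.cast_zero]

/-- If the inner product of two characters vanishes, they have no common irreducible
constituent. -/
theorem IsCharacter.charInner_mul_charInner_eq_zero {H : Type*} [Group H] [Finite H]
    {f h β : H → ℂ} (hf : IsCharacter f) (hh : IsCharacter h) (hβ : β ∈ Irr H)
    (h0 : charInner f h = 0) : charInner f β * charInner β h = 0 := by
  rw [charInner_eq_sum_irr f h hf.conj_apply] at h0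
  refine eq_zero_of_sum_natCast_eq_zero (fun θ hθ => ?_) h0 β (mem_irrFinset.2 hβ)
  have hθ' := Irr.isCharacter (mem_irrFinset.1 hθ)
  obtain ⟨a, ha⟩ := hf.exists_charInner_eq_natCast hθ'
  obtain ⟨b, hb⟩ := hθ'.exists_charInner_eq_natCast hh
  exact ⟨a * b, by rw [ha, hb, Nat.cast_mul]⟩

/-- Clifford's theorem: the irreducible constituents of the restriction of an irreducible character
to a normal subgroup are conjugate. -/
theorem exists_eq_conjFun {θ : G → ℂ} (hθ : θ ∈ Irr G) {γ β : N → ℂ} (hγ : γ ∈ Irr N)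
    (hβ : β ∈ Irr N) (hγθ : charInner γ (restrict N θ) ≠ 0)
    (hθβ : charInner (restrict N θ) β ≠ 0) : ∃ x : G, β = conjFun N x γ := by
  have := Fintype.ofFinite G
  -- Otherwise `β` would not occur in the restriction of `γ^G`, although `θ` occurs in `γ^G` and `β`
  -- in `θ_N`; no cancellation is possible, as all multiplicities are natural numbers.
  by_contra! hne
  have h1 : charInner (restrict N (induce N γ)) β = 0 := by
    rw [restrict_induce, charInner_smul_left, charInner_sum_left,
      Finset.sum_eq_zero fun x _ =>
        charInner_eq_zero_of_mem_irr (conjFun_mem_irr x hγ) hβ (hne x).symm, mul_zero]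
  have h2 : restrict N (induce N γ) =
      ∑ τ ∈ irrFinset G, charInner γ (restrict N τ) • restrict N τ := by
    conv_lhs => rw [← sum_charInner_smul_eq (induce N γ) (induce_conj_apply N γ)]
    funext n
    simp only [restrict, Finset.sum_apply, Pi.smul_apply]
    refine Finset.sum_congr rfl fun τ hτ => ?_
    rw [charInner_induce N γ τ (Irr.isCharacter (mem_irrFinset.1 hτ)).conj_apply]
  rw [h2, charInner_sum_left] at h1
  simp only [charInner_smul_left] at h1
  refine mul_ne_zero hγθ hθβ
    (eq_zero_of_sum_natCast_eq_zero (fun τ hτ => ?_) h1 θ (mem_irrFinset.2 hθ))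
  have hτ' := (Irr.isCharacter (mem_irrFinset.1 hτ)).restrict N
  obtain ⟨a, ha⟩ := (Irr.isCharacter hγ).exists_charInner_eq_natCast hτ'
  obtain ⟨b, hb⟩ := hτ'.exists_charInner_eq_natCast (Irr.isCharacter hβ)
  exact ⟨a * b, by rw [ha, hb, Nat.cast_mul]⟩

/-- The constituents of `θ_N` are the conjugates of `γ`, all with the same multiplicity, so this
multiplicity divides the degree of `θ`. -/
theorem multiplicity_dvd_degree {θ : G → ℂ} (hθ : θ ∈ Irr G) {γ : N → ℂ} (hγ : γ ∈ Irr N)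
    {m d : ℕ} (hm : charInner γ (restrict N θ) = m) (hm0 : m ≠ 0) (hd : θ 1 = d) : m ∣ d := by
  have hθc := Irr.isCharacter hθ
  have hNc := hθc.restrict N
  have hterm : ∀ β ∈ irrFinset N, ∃ k : ℕ, charInner (restrict N θ) β * β 1 = (m * k : ℕ) := by
    intro β hβ
    rw [mem_irrFinset] at hβ
    by_cases h0 : charInner (restrict N θ) β = 0
    · exact ⟨0, by simp [h0]⟩
    · obtain ⟨x, rfl⟩ := exists_eq_conjFun hθ hγ hβ (by rw [hm]; exact_mod_cast hm0) h0
      obtain ⟨c, -, -, hc⟩ := exists_degree_of_mem_irr hβ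
      refine ⟨c, ?_⟩
      rw [hNc.charInner_comm (Irr.isCharacter hβ), charInner_conjFun_restrict x γ θ hθc.conj_apply,
        hm, hc, Nat.cast_mul]
  choose! k hk using hterm
  have h1 := congrFun (sum_charInner_smul_eq (restrict N θ) hNc.conj_apply) 1
  have h2 : (d : ℂ) = ∑ β ∈ irrFinset N, ((m * k β : ℕ) : ℂ) := by
    rw [← hd, ← Finset.sum_congr rfl hk]
    simpa [restrict] using h1.symm
  have h3 : d = ∑ β ∈ irrFinset N, m * k β := by exact_mod_cast h2
  rw [h3]
  exact Finset.dvd_sum fun β _ => dvd_mul_right _ _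

/-- `[γ^G, γ^G]` is the index of `N` in the stabiliser of `γ`. -/
theorem exists_charInner_induce_self {γ : N → ℂ} (hγ : γ ∈ Irr N) :
    ∃ k : ℕ, charInner (induce N γ) (induce N γ) = k ∧ k ∣ N.index := by
  classical
  have := Fintype.ofFinite G
  let S : Subgroup G :=
    { carrier := {x | conjFun N x γ = γ}
      one_mem' := conjFun_one γ
      mul_mem' := fun {x y} hx hy => by
        simp only [Set.mem_ofPred_eq] at *
        rw [conjFun_mul, hx, hy]
      inv_mem' := fun {x} hx => by
        simp only [Set.mem_ofPred_eq] at *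
        conv_lhs => rw [← hx]
        rw [← conjFun_mul, mul_inv_cancel, conjFun_one] }
  have hS : ∀ x, x ∈ S ↔ conjFun N x γ = γ := fun x => Iff.rfl
  have hNS : N ≤ S := fun n hn => by
    rw [hS]
    funext y
    have h : MulAut.conjNormal n y = (⟨n, hn⟩ : N) * y * (⟨n, hn⟩ : N)⁻¹ := by
      ext; simp
    rw [conjFun_apply, h, (Irr.isCharacter hγ).conj_apply]
  refine ⟨N.relIndex S, ?_, Dvd.intro _ (Subgroup.relIndex_mul_index hNS)⟩
  have hterm : ∀ x : G, charInner (conjFun N x γ) γ = if x ∈ S then 1 else 0 := fun x => by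
    split_ifs with h
    · rw [(hS x).1 h, charInner_self_of_mem_irr hγ]
    · exact charInner_eq_zero_of_mem_irr (conjFun_mem_irr x hγ) hγ fun h' => h ((hS x).2 h')
  rw [charInner_induce N γ _ (induce_conj_apply N γ), ← star_charInner, restrict_induce,
    charInner_smul_left, charInner_sum_left]
  simp only [hterm]
  rw [Finset.sum_boole, ← Fintype.card_subtype, Fintype.card_eq_nat_card]
  have hcard : Nat.card S = Nat.card N * N.relIndex S := by
    rw [← Subgroup.relIndex_bot_left S, ← Subgroup.relIndex_bot_left N,
      Subgroup.relIndex_mul_relIndex _ _ _ bot_le hNS]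
  have h0 : (Nat.card N : ℂ) ≠ 0 := NeZero.ne _
  change starRingEnd ℂ ((Nat.card N : ℂ)⁻¹ * (Nat.card S : ℂ)) = _
  rw [hcard, Nat.cast_mul, inv_mul_cancel_left₀ h0, map_natCast]

end Clifford

/-! ### Constituents of induced characters of `p`-groups -/

section PGroup

variable {G : Type*} [Group G] [Finite G] {p : ℕ} [hp : Fact p.Prime]

/-- If `G` is a `p`-group, the multiplicities in `γ^G` and the sum of their squares are powers of
`p`, so the number of irreducible constituents is congruent to `1` modulo `p - 1`. -/
theorem induce_eq_smul_of_encard_constituents_lt (hG : IsPGroup p G) (N : Subgroup G) [N.Normal]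
    {γ : N → ℂ} (hγ : γ ∈ Irr N) (hlt : (constituents (induce N γ)).encard < p) :
    ∃ θ ∈ Irr G, ∃ m : ℕ, 0 < m ∧ m * m ∣ N.index ∧ induce N γ = (m : ℂ) • θ := by
  have hp1 : 1 < p := hp.out.one_lt
  have hpow : ∀ {d : ℕ}, d ∣ Nat.card G → d ≡ 1 [MOD p - 1] := fun {d} hd => by
    obtain ⟨n, hn⟩ := IsPGroup.iff_card.1 hG
    rw [hn, Nat.dvd_prime_pow hp.out] at hd
    obtain ⟨j, -, rfl⟩ := hd
    have h : p ≡ 1 [MOD p - 1] := (Nat.modEq_sub hp1.le)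
    simpa using h.pow j
  have hex : ∀ θ ∈ irrFinset G, ∃ m : ℕ, charInner (induce N γ) θ = m ∧
      charInner γ (restrict N θ) = m := fun θ hθ => by
    have hθc := Irr.isCharacter (mem_irrFinset.1 hθ)
    obtain ⟨m, hm⟩ := (Irr.isCharacter hγ).exists_charInner_eq_natCast (hθc.restrict N)
    exact ⟨m, by rw [charInner_induce N γ θ hθc.conj_apply, hm], hm⟩
  choose! m hm hm' using hex
  obtain ⟨k, hk, hkdvd⟩ := exists_charInner_induce_self hγ
  have hcl := induce_conj_apply N γ
  set s := (irrFinset G).filter fun θ => m θ ≠ 0 with hs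
  -- Parseval's identity for `[γ^G, γ^G]`.
  have hsum : ∑ θ ∈ s, m θ * m θ = k := by
    have h1 := charInner_eq_sum_irr (induce N γ) (induce N γ) hcl
    rw [hk, Finset.sum_congr rfl (g := fun θ => ((m θ * m θ : ℕ) : ℂ)) fun θ hθ => by
      rw [← star_charInner (induce N γ) θ, hm θ hθ, map_natCast, Nat.cast_mul]] at h1
    have h2 : k = ∑ θ ∈ irrFinset G, m θ * m θ := by exact_mod_cast h1
    rw [h2, hs]
    exact Finset.sum_filter_of_ne fun θ _ h h0 => h (by simp [h0])
  have hkG : k ∣ Nat.card G := hkdvd.trans N.index_dvd_card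
  -- The multiplicities divide degrees, hence are powers of `p` and congruent to `1`.
  have hm1 : ∀ θ ∈ s, m θ * m θ ≡ 1 [MOD p - 1] := fun θ hθ => by
    obtain ⟨hθ, h0⟩ := Finset.mem_filter.1 hθ
    obtain ⟨d, -, hd, hd1⟩ := exists_degree_of_mem_irr (mem_irrFinset.1 hθ)
    have h := hpow ((multiplicity_dvd_degree (mem_irrFinset.1 hθ) hγ (hm' θ hθ) h0 hd1).trans hd)
    simpa using h.mul h
  have hcardmod : s.card ≡ 1 [MOD p - 1] := by
    have h : ∑ θ ∈ s, m θ * m θ ≡ ∑ θ ∈ s, 1 [MOD p - 1] := Nat.ModEq.sum hm1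
    rw [hsum] at h
    simpa using h.symm.trans (hpow hkG)
  have hcardlt : s.card < p := by
    have hsub : (s : Set (G → ℂ)) ⊆ constituents (induce N γ) := fun θ hθ => by
      obtain ⟨hθ, h0⟩ := Finset.mem_filter.1 (Finset.mem_coe.1 hθ)
      exact ⟨mem_irrFinset.1 hθ, by rw [hm θ hθ]; exact_mod_cast h0⟩
    have h := (Set.encard_le_encard hsub).trans_lt hlt
    rw [Set.encard_coe_eq_coe_finsetCard] at h
    exact_mod_cast h
  have hcardpos : s.card ≠ 0 := fun h => by
    rw [Finset.card_eq_zero] at h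
    rw [h, Finset.sum_empty] at hsum
    rw [← hsum, Nat.zero_dvd] at hkG
    exact Nat.card_pos.ne' hkG
  have hcard : s.card = 1 := by
    have h := (Nat.modEq_iff_dvd' (Nat.one_le_iff_ne_zero.2 hcardpos)).1 hcardmod.symm
    have := Nat.eq_zero_of_dvd_of_lt h (by omega)
    omega
  obtain ⟨θ, hθs⟩ := Finset.card_eq_one.1 hcard
  obtain ⟨hθ, h0⟩ := Finset.mem_filter.1 (show θ ∈ s by simp [hθs])
  refine ⟨θ, mem_irrFinset.1 hθ, m θ, Nat.pos_of_ne_zero h0, ?_, ?_⟩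
  · rw [hθs, Finset.sum_singleton] at hsum
    rwa [hsum]
  · conv_lhs => rw [← sum_charInner_smul_eq (induce N γ) hcl]
    rw [Finset.sum_eq_single_of_mem θ hθ fun τ hτ hne => ?_, hm θ hθ]
    have hτs : τ ∉ s := by simpa [hθs] using hne
    have hτ0 : m τ = 0 := by
      by_contra h
      exact hτs (Finset.mem_filter.2 ⟨hτ, h⟩)
    rw [hm τ hτ, hτ0, Nat.cast_zero, zero_smul]

end PGroup

/-! ### Constituents of products -/

section Products

variable {G : Type*} [Group G] [Finite G]

/-- If `χ` is, up to a scalar, induced from `N`, then every constituent `γ` of `(χψ)_N` satisfies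
`constituents (γ^G) ⊆ constituents (χψ)`. -/
theorem constituents_induce_subset {χ ψ : G → ℂ} (hψ : ψ ∈ Irr G)
    (N : Subgroup G) [N.Normal] {α γ : N → ℂ} (hα : α ∈ Irr N) (hγ : γ ∈ Irr N) {e : ℂ}
    (hind : induce N α = e • χ) (hcon : charInner γ (restrict N (χ * ψ)) ≠ 0) :
    constituents (induce N γ) ⊆ constituents (χ * ψ) := by
  have := Fintype.ofFinite G
  rintro θ ⟨hθ, hγθ⟩
  refine ⟨hθ, fun h0 => ?_⟩
  have hθc := Irr.isCharacter hθ
  have hψc := Irr.isCharacter hψ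
  rw [charInner_induce N γ θ hθc.conj_apply] at hγθ
  have hαψ : IsCharacter (α * restrict N ψ) := (Irr.isCharacter hα).mul (hψc.restrict N)
  have h1 : charInner (α * restrict N ψ) (restrict N θ) = 0 := by
    rw [← charInner_induce N _ θ hθc.conj_apply, induce_mul_restrict N α ψ hψc.conj_apply, hind,
      smul_mul_assoc, charInner_smul_left, h0, mul_zero]
  -- `γ` conjugated by `x⁻¹` is a constituent of `θ_N`, so it does not occur in `α * ψ_N`;
  -- conjugating back by `x` moves the conjugation onto `α`.
  have h2 : ∀ x : G, charInner (conjFun N x α * restrict N ψ) γ = 0 := fun x => by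
    have h3 := hαψ.charInner_mul_charInner_eq_zero (hθc.restrict N) (conjFun_mem_irr x⁻¹ hγ) h1
    rw [charInner_conjFun_restrict _ _ _ hθc.conj_apply] at h3
    rw [← (mul_eq_zero.1 h3).resolve_right hγθ, ← charInner_conjFun x (α * restrict N ψ),
      ← conjFun_mul, inv_mul_cancel, conjFun_one]
    congr 1
    conv_lhs => rw [← conjFun_restrict x ψ hψc.conj_apply]
    rfl
  have h3 : e • restrict N (χ * ψ) =
      (Nat.card N : ℂ)⁻¹ • ∑ x : G, conjFun N x α * restrict N ψ := by
    rw [← Finset.sum_mul, ← smul_mul_assoc, ← restrict_induce, hind]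
    funext n
    simp [restrict, mul_assoc]
  have h4 : e * charInner (restrict N (χ * ψ)) γ = 0 := by
    rw [← charInner_smul_left, h3, charInner_smul_left, charInner_sum_left,
      Finset.sum_eq_zero fun x _ => h2 x, mul_zero]
  -- The value of `α^G` at `1` is `|G : N| α(1)`, which is nonzero.
  have he : e ≠ 0 := by
    rintro rfl
    obtain ⟨d, hd0, -, hd⟩ := exists_degree_of_mem_irr hα
    have h5 := congrFun hind 1
    rw [induce_apply_one, hd, zero_smul, Pi.zero_apply] at h5
    have h6 : N.index * d = 0 := by exact_mod_cast h5
    exact (mul_ne_zero Subgroup.index_ne_zero_of_finite hd0.ne') h6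
  apply hcon
  rw [← star_charInner, (mul_eq_zero.1 h4).resolve_left he, map_zero]

end Products
end CharacterTheory

theorem theoremB {G : Type*} [Group G] [Finite G] (p : ℕ) [Fact p.Prime] (hG : IsPGroup p G)
    (χ ψ : G → ℂ) (hχ : χ ∈ CharacterTheory.Irr G) (hψ : ψ ∈ CharacterTheory.Irr G)
    (heta : CharacterTheory.eta (χ * ψ) < p)
    (N : Subgroup G) (hN : N.Normal)
    (α γ : N → ℂ) (hα : α ∈ CharacterTheory.Irr N) (hγ : γ ∈ CharacterTheory.Irr N)
    (e : ℤ) (hind : CharacterTheory.induce N α = (e : ℂ) • χ)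
    (hcon : CharacterTheory.charInner γ (CharacterTheory.restrict N (χ * ψ)) ≠ 0) :
    (∃ θ ∈ CharacterTheory.Irr G, ∃ m : ℕ, 0 < m ∧
      CharacterTheory.induce N γ = (m : ℂ) • θ) ∧
    (N.index = p → CharacterTheory.induce N γ ∈ CharacterTheory.Irr G) := by
  obtain ⟨θ, hθ, m, hm, hmdvd, h⟩ :=
    CharacterTheory.induce_eq_smul_of_encard_constituents_lt hG N hγ
      ((Set.encard_le_encard
        (CharacterTheory.constituents_induce_subset hψ N hα hγ hind hcon)).trans_lt heta)
  refine ⟨⟨θ, hθ, m, hm, h⟩, fun hidx => ?_⟩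
  rw [hidx] at hmdvd
  have hm1 : m = 1 := Nat.isUnit_iff.1 ((Fact.out : p.Prime).prime.squarefree m hmdvd)
  rwa [h, hm1, Nat.cast_one, one_smul]
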